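/- For a finite simple undirected graph $G$ and a vertex set $S\subseteq V(G)$, write $G[S]$ for the subgraph induced by $S$ and $[S,V(G)\setminus S]$ for the set of edges of $G$ with exactly one end in $S$. The problem $\textsc{Comp-Sub}(\mathcal{PM})$ takes as input a finite simple undirected graph $G$ and asks whether $V(G)$ can be partitioned into two sets $V_1,V_2$ such that, for some graph $H$, $G[V_1]$ is isomorphic to $H$, $G[V_2]$ is isomorphic to the complement $\overline{H}$, and the edge cut $[V_1,V_2]$ is a perfect matching of $G$ (that is, every vertex of $G$ is an end of exactly one edge of $[V_1,V_2]$). A graph is $P_5$-free if it has no induced subgraph isomorphic to the path $P_5$ on five vertices. Theorem. $\textsc{Comp-Sub}(\mathcal{PM})$ is polynomial-time solvable on $P_5$-free graphs: there are a deterministic Turing machine and a polynomial $p$ such that, for every $P_5$-free graph $G$, the machine, given $G$ by its adjacency matrix, halts after at most $p(\ell)$ steps, where $\ell$ is the length of the input string, and correctly answers whether $G$ is a yes-instance of $\textsc{Comp-Sub}(\mathcal{PM})$. -/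

import Mathlib

/-- `G` is `F`-free: `G` has no induced subgraph isomorphic to `F`. -/
def IsInducedFree {W V : Type*} (F : SimpleGraph W) (G : SimpleGraph V) : Prop :=
  ¬ F.IsIndContained G

/-- The edge cut `[s, V \ s]` of `G`, as a spanning subgraph of `G`: its edges are the edges of `G`
with one end in `s` and the other end outside `s`. -/
def edgeCut {V : Type*} (G : SimpleGraph V) (s : Set V) : G.Subgraph :=
  SimpleGraph.toSubgraph (G.between s sᶜ) SimpleGraph.between_le

/-- `G` is a yes-instance of Partition Into Complementary Subgraphs for the edge set property `P`:
the vertex set can be partitioned into `s` and its complement such that, for some graph `H`,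
`G[s]` is (isomorphic to) `H`, `G[V \ s]` is (isomorphic to) the complement of `H`,
and the edge cut of this decomposition satisfies `P`. -/
def CompSub {V : Type*} (G : SimpleGraph V) (P : G.Subgraph → Prop) : Prop :=
  ∃ (s : Set V) (H : SimpleGraph s),
    Nonempty (G.induce s ≃g H) ∧ Nonempty (G.induce sᶜ ≃g Hᶜ) ∧ P (edgeCut G s)

/-- Yes-instances when the edge cut is required to be a perfect matching of `G`. -/
def CompSubPM {V : Type*} (G : SimpleGraph V) : Prop :=
  CompSub G SimpleGraph.Subgraph.IsPerfectMatching

/-- Finite simple undirected graphs as algorithmic inputs: the vertices are `0, …, n - 1`. -/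
abbrev FinGraph : Type := Σ n : ℕ, SimpleGraph (Fin n)

open Classical in
/-- The adjacency matrix of a graph, written row by row, as a string over the three-letter alphabet
`Option Bool`. The letters `some true` and `some false` are the matrix entries 1 and 0,
and `none` marks the end of a row. -/
noncomputable def encodeGraph (G : FinGraph) : List (Option Bool) :=
  (List.finRange G.1).flatMap fun i =>
    ((List.finRange G.1).map fun j => some (decide (G.2.Adj i j))) ++ [none]

/-- The decision problem `Q` on graphs is solvable in polynomial time on the graph class `C`:
some Turing machine, started on the encoding of any graph `G` of the class, halts after a number of
steps bounded by a fixed polynomial in the length of the encoding, with output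
`true` if `Q G` holds and `false` otherwise. -/
def PolyTimeSolvableOn (C Q : FinGraph → Prop) : Prop :=
  ∃ f : {G : FinGraph // C G} → Bool, (∀ G, f G = true ↔ Q G.1) ∧
    Nonempty (Turing.TM2ComputableInPolyTime
      (fun G : {G : FinGraph // C G} => encodeGraph G.1) Computability.encodeBool f)

/-! A `P₅`-free yes-instance is a clique and an independent set of equal size joined by a perfect
matching, and such graphs are visible in their degrees. Let `p` be the partner map of the cut. An
induced `P₄` in `G[s]` extends by the partner of an end to an induced `P₅`, so `G[s]` is `P₄`-free
and, by Seinsche's theorem, it or its complement is disconnected. Since `G[sᶜ]` is isomorphic to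
that complement, the sides can be named so that `G[sᶜ]` and the complement of `G[s]` are both
disconnected. If `x y` is an edge in `s` and `p x`, `p y` are not adjacent, then these have the same
neighbours in `sᶜ` (`IsPartner.twin`). By `not_adj_of_isSplit` this leaves `G[sᶜ]` without edges, so
`G[s]` is complete. With `N` vertices, the clique vertices then have degree `N / 2` and the others
degree 1. Conversely, double counting recovers the structure from these degrees
(`LeafHalfBalanced.compSubPM`). A linear-time machine checks the degrees, comparing ones with zeros
in each row of the matrix by a signed unary counter (`runs_read_text`). -/

/-! ### Graphs without induced `P₄` -/

/-- `G` has no induced path on four vertices, in elementary terms. -/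
def PathFourFree {V : Type*} (G : SimpleGraph V) : Prop :=
  ∀ a b c d, G.Adj a b → G.Adj b c → G.Adj c d → ¬G.Adj a c → ¬G.Adj a d → ¬G.Adj b d → False

/-- `P₄` is self-complementary: a path `a b c d` in the complement is the path `b d a c` in `G`. -/
lemma PathFourFree.compl {V : Type*} {G : SimpleGraph V} (h : PathFourFree G) :
    PathFourFree Gᶜ := by
  intro a b c d hab hbc hcd hac had hbd
  simp only [SimpleGraph.compl_adj, not_and, not_not] at *
  have h1 : a ≠ c := by rintro rfl; exact (had hcd.1 |> fun h => hcd.2 h)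
  have h2 : a ≠ d := by rintro rfl; exact hcd.2 (hac h1).symm
  have h3 : b ≠ d := by rintro rfl; exact hab.2 (had h2)
  exact h b d a c (hbd h3) (had h2).symm (hac h1) (fun h => hab.2 h.symm) hbc.2
    (fun h => hcd.2 h.symm)

/-- `S` is a proper nonempty part of `F` with no edge of `G` to the rest of `F`. -/
def IsSplit {V : Type*} (G : SimpleGraph V) (F S : Set V) : Prop :=
  S ⊆ F ∧ S.Nonempty ∧ (F \ S).Nonempty ∧ ∀ x ∈ S, ∀ y ∈ F \ S, ¬G.Adj x y

/-- If `v` misses one side of the split, that side stays separated. If it has neighbours on both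
sides but misses some vertex of one side, its non-neighbours there are separated: an edge `x y` to a
neighbour `y` of `v` on that side would give a `P₄` `x y v q` with `q` across. Otherwise `v` is
isolated in the complement. -/
lemma PathFourFree.exists_isSplit_insert {V : Type*} {G : SimpleGraph V} (h : PathFourFree G)
    {F S : Set V} {v : V} (hv : v ∉ F) (hS : IsSplit G F S) :
    ∃ R, IsSplit G (insert v F) R ∨ IsSplit Gᶜ (insert v F) R := by
  obtain ⟨hSF, ⟨s, hs⟩, ⟨t, ht⟩, hST⟩ := hS
  have hvS : v ∉ S := fun hh => hv (hSF hh)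
  by_cases h1 : ∀ x ∈ S, ¬G.Adj v x
  · refine ⟨S, .inl ⟨fun x hx => .inr (hSF hx), ⟨s, hs⟩, ⟨v, .inl rfl, hvS⟩, ?_⟩⟩
    rintro x hx y ⟨rfl | hy, hyS⟩ hxy
    · exact h1 x hx hxy.symm
    · exact hST x hx y ⟨hy, hyS⟩ hxy
  by_cases h2 : ∀ x ∈ F \ S, ¬G.Adj v x
  · refine ⟨F \ S, .inl ⟨fun x hx => .inr hx.1, ⟨t, ht⟩, ⟨v, .inl rfl, fun hh => hv hh.1⟩, ?_⟩⟩
    rintro x hx y ⟨rfl | hy, hyS⟩ hxy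
    · exact h2 x hx hxy.symm
    · exact hST y (by by_contra hn; exact hyS ⟨hy, hn⟩) x hx hxy.symm
  push Not at h1 h2
  obtain ⟨p, hp, hvp⟩ := h1
  obtain ⟨q, hq, hvq⟩ := h2
  by_cases h3 : ∃ x ∈ S, ¬G.Adj v x
  · obtain ⟨w, hw, hvw⟩ := h3
    refine ⟨{x ∈ S | ¬G.Adj v x}, .inl ⟨fun x hx => .inr (hSF hx.1), ⟨w, hw, hvw⟩,
      ⟨v, .inl rfl, fun hh => hvS hh.1⟩, ?_⟩⟩
    rintro x ⟨hx, hvx⟩ y ⟨rfl | hy, hyS⟩ hxy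
    · exact hvx hxy.symm
    · by_cases hyS' : y ∈ S
      · have hvy : G.Adj v y := by by_contra hn; exact hyS ⟨hyS', hn⟩
        exact h x y v q hxy hvy.symm hvq (fun hh => hvx hh.symm) (hST x hx q hq) (hST y hyS' q hq)
      · exact hST x hx y ⟨hy, hyS'⟩ hxy
  by_cases h4 : ∃ x ∈ F \ S, ¬G.Adj v x
  · obtain ⟨w, hw, hvw⟩ := h4
    refine ⟨{x ∈ F \ S | ¬G.Adj v x}, .inl ⟨fun x hx => .inr hx.1.1, ⟨w, hw, hvw⟩,
      ⟨v, .inl rfl, fun hh => hv hh.1.1⟩, ?_⟩⟩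
    rintro x ⟨hx, hvx⟩ y ⟨rfl | hy, hyS⟩ hxy
    · exact hvx hxy.symm
    · by_cases hyS' : y ∈ S
      · exact hST y hyS' x hx hxy.symm
      · have hvy : G.Adj v y := by by_contra hn; exact hyS ⟨⟨hy, hyS'⟩, hn⟩
        exact h x y v p hxy hvy.symm hvp (fun hh => hvx hh.symm)
          (fun hh => hST p hp x hx hh.symm) (fun hh => hST p hp y ⟨hy, hyS'⟩ hh.symm)
  push Not at h3 h4
  refine ⟨{v}, .inr ⟨by simp, ⟨v, rfl⟩, ⟨s, .inr (hSF hs), fun hh => hvS (hh ▸ hs)⟩, ?_⟩⟩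
  rintro x rfl y ⟨hy, hyx⟩ hxy
  rcases hy with rfl | hy
  · exact hyx rfl
  · by_cases hyS : y ∈ S
    · exact hxy.2 (h3 y hyS)
    · exact hxy.2 (h4 y ⟨hy, hyS⟩)

/-- Seinsche's theorem: a finite graph without induced `P₄` on at least two vertices, or its
complement, is disconnected. -/
lemma PathFourFree.exists_isSplit {V : Type*} {G : SimpleGraph V} (h : PathFourFree G)
    (F : Finset V) (hF : 1 < F.card) : ∃ R, IsSplit G (F : Set V) R ∨ IsSplit Gᶜ (F : Set V) R := by
  classical
  induction F using Finset.induction_on with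
  | empty => simp at hF
  | insert v F hv ih =>
    rw [Finset.coe_insert]
    by_cases h1 : 1 < F.card
    · obtain ⟨R, hR | hR⟩ := ih h1
      · exact h.exists_isSplit_insert (by simpa using hv) hR
      · obtain ⟨Q, hQ⟩ := h.compl.exists_isSplit_insert (by simpa using hv) hR
        exact ⟨Q, by rwa [compl_compl, or_comm] at hQ⟩
    · rw [Finset.card_insert_of_notMem hv] at hF
      obtain ⟨w, rfl⟩ := Finset.card_eq_one.1 (show F.card = 1 by omega)
      have hvw : v ≠ w := by simpa using hv
      refine ⟨{v}, ?_⟩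
      by_cases ha : G.Adj v w
      · refine .inr ⟨by simp, by simp, ⟨w, by simp, hvw.symm⟩, ?_⟩
        rintro x rfl y ⟨hy, hyx⟩ hxy
        have : y = w := by simpa [show y ≠ x from hyx] using hy
        exact hxy.2 (this ▸ ha)
      · refine .inl ⟨by simp, by simp, ⟨w, by simp, hvw.symm⟩, ?_⟩
        rintro x rfl y ⟨hy, hyx⟩ hxy
        have : y = w := by simpa [show y ≠ x from hyx] using hy
        exact ha (this ▸ hxy)

/-! ### Two graphs on one vertex set -/

/-- If `B` is disconnected, `A` has a disconnected complement, and the ends of every edge of `A`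
that is no edge of `B` have the same neighbours in `B`, then `B` has no edges. -/
lemma not_adj_of_isSplit {α : Type*} {A B : SimpleGraph α} {S R : Set α}
    (hS : IsSplit Aᶜ Set.univ S) (hR : IsSplit B Set.univ R)
    (htwin : ∀ i j k, A.Adj i j → ¬B.Adj i j → B.Adj j k → B.Adj i k) (j k : α) :
    ¬B.Adj j k := by
  obtain ⟨-, ⟨s, hs⟩, ⟨t, -, ht⟩, hST⟩ := hS
  obtain ⟨-, ⟨s', hs'⟩, ⟨t', -, ht'⟩, hR⟩ := hR
  have hA : ∀ x ∈ S, ∀ y ∉ S, A.Adj x y := by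
    intro x hx y hy
    have := hST x hx y ⟨trivial, hy⟩
    rw [SimpleGraph.compl_adj] at this
    by_contra hn
    exact this ⟨fun e => hy (e ▸ hx), hn⟩
  have hB : ∀ x ∈ R, ∀ y ∉ R, ¬B.Adj x y := fun x hx y hy => hR x hx y ⟨trivial, hy⟩
  -- Being isolated in `B` passes along edges of `A`.
  have spread : ∀ x y, A.Adj x y → (∀ z, ¬B.Adj x z) → ∀ z, ¬B.Adj y z :=
    fun x y hxy hx z hyz => hx z (htwin x y z hxy (hx y) hyz)
  -- A `B`-neighbour of `x` would also be one of `y`, but `x` and `y` lie on opposite sides of the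
  -- split of `B`.
  have cross : ∀ x ∈ R, ∀ y ∉ R, A.Adj x y → ∀ z, ¬B.Adj x z := by
    intro x hx y hy hxy z hxz
    have hyz := htwin y x z hxy.symm (fun h => hB x hx y hy h.symm) hxz
    by_cases hz : z ∈ R
    · exact hB z hz y hy hyz.symm
    · exact hB x hx z hz hxz
  -- Some edge of `A` crosses `R`: either `s'` and `t'` are separated by `S`, or a vertex on the
  -- other side of `S` is `A`-adjacent to both.
  have hex : ∃ x, ∀ z, ¬B.Adj x z := by
    by_cases h1 : s' ∈ S <;> by_cases h2 : t' ∈ S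
    · by_cases h3 : t ∈ R
      · exact ⟨t, cross t h3 t' ht' (hA t' h2 t ht).symm⟩
      · exact ⟨s', cross s' hs' t h3 (hA s' h1 t ht)⟩
    · exact ⟨s', cross s' hs' t' ht' (hA s' h1 t' h2)⟩
    · exact ⟨s', cross s' hs' t' ht' (hA t' h2 s' h1).symm⟩
    · by_cases h3 : s ∈ R
      · exact ⟨s, cross s h3 t' ht' (hA s hs t' h2)⟩
      · exact ⟨s', cross s' hs' s h3 (hA s hs s' h1).symm⟩
  obtain ⟨x, hx⟩ := hex
  -- Isolation spreads from `x` to the whole opposite side of `S`, and from there back to the side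
  -- of `x`.
  by_cases hxS : x ∈ S
  · have hT : ∀ y ∉ S, ∀ z, ¬B.Adj y z := fun y hy => spread x y (hA x hxS y hy) hx
    by_cases hj : j ∈ S
    · exact spread t j (hA j hj t ht).symm (hT t ht) k
    · exact hT j hj k
  · have hT : ∀ y ∈ S, ∀ z, ¬B.Adj y z := fun y hy => spread x y (hA y hy x hxS).symm hx
    by_cases hj : j ∈ S
    · exact hT j hj k
    · exact spread s j (hA s hs j hj) (hT s hs) k

/-! ### Structure of `P₅`-free yes-instances -/

lemma IsInducedFree.not_pathFive {V : Type*} {G : SimpleGraph V}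
    (h : IsInducedFree (SimpleGraph.pathGraph 5) G) (a b c d e : V)
    (hab : G.Adj a b) (hbc : G.Adj b c) (hcd : G.Adj c d) (hde : G.Adj d e)
    (hac : ¬G.Adj a c) (had : ¬G.Adj a d) (hae : ¬G.Adj a e) (hbd : ¬G.Adj b d)
    (hbe : ¬G.Adj b e) (hce : ¬G.Adj c e) : False := by
  apply h
  have hadj : ∀ i j : Fin 5, G.Adj (![a, b, c, d, e] i) (![a, b, c, d, e] j) ↔
      (SimpleGraph.pathGraph 5).Adj i j := by
    intro i j
    rw [SimpleGraph.pathGraph_adj]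
    have hca := mt G.adj_symm hac
    have hda := mt G.adj_symm had
    have hea := mt G.adj_symm hae
    have hdb := mt G.adj_symm hbd
    have heb := mt G.adj_symm hbe
    have hec := mt G.adj_symm hce
    fin_cases i <;> fin_cases j <;> simp [*, hab.symm, hbc.symm, hcd.symm, hde.symm]
  refine ⟨⟨⟨![a, b, c, d, e], ?_⟩, hadj _ _⟩⟩
  intro i j hij
  -- Injectivity comes for free, as distinct vertices of `P₅` have distinct neighbourhoods.
  have key : ∀ k, (SimpleGraph.pathGraph 5).Adj i k ↔ (SimpleGraph.pathGraph 5).Adj j k := by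
    intro k; rw [← hadj, ← hadj, hij]
  simp only [SimpleGraph.pathGraph_adj] at key
  clear hij
  revert i j
  decide

lemma IsSplit.preimage {α β : Type*} {G : SimpleGraph β} {S : Set β} (h : IsSplit G Set.univ S)
    (f : α → β) (hf : Function.Surjective f) : IsSplit (G.comap f) Set.univ (f ⁻¹' S) := by
  obtain ⟨-, ⟨s, hs⟩, ⟨t, -, ht⟩, hST⟩ := h
  obtain ⟨s, rfl⟩ := hf s
  obtain ⟨t, rfl⟩ := hf t
  exact ⟨Set.subset_univ _, ⟨s, hs⟩, ⟨t, trivial, ht⟩,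
    fun x hx y hy => hST _ hx _ ⟨trivial, hy.2⟩⟩

/-- The edges of `G` between `s` and its complement form a perfect matching. -/
def IsMatchingCut {V : Type*} (G : SimpleGraph V) (s : Set V) : Prop :=
  ∀ v, ∃! w, G.Adj v w ∧ (v ∈ s ↔ w ∉ s)

lemma edgeCut_isPerfectMatching_iff {V : Type*} {G : SimpleGraph V} {s : Set V} :
    (edgeCut G s).IsPerfectMatching ↔ IsMatchingCut G s := by
  rw [SimpleGraph.Subgraph.isPerfectMatching_iff]
  refine forall_congr' fun v => ?_
  have : ∀ w, (edgeCut G s).Adj v w ↔ G.Adj v w ∧ (v ∈ s ↔ w ∉ s) := by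
    intro w
    simp only [edgeCut, SimpleGraph.toSubgraph, SimpleGraph.between_adj, Set.mem_compl_iff]
    tauto
  simp only [this]

/-- `p` sends every vertex to its partner in the matching cut `[s, V \ s]`. -/
structure IsPartner {V : Type*} (G : SimpleGraph V) (s : Set V) (p : V → V) : Prop where
  adj : ∀ v, G.Adj v (p v)
  mem_iff : ∀ v, v ∈ s ↔ p v ∉ s
  eq : ∀ v w, G.Adj v w → (v ∈ s ↔ w ∉ s) → w = p v

lemma IsMatchingCut.exists_isPartner {V : Type*} {G : SimpleGraph V} {s : Set V}
    (h : IsMatchingCut G s) : ∃ p, IsPartner G s p := by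
  choose p hp hu using h
  exact ⟨p, fun v => (hp v).1, fun v => (hp v).2, fun v w h1 h2 => hu v w ⟨h1, h2⟩⟩

namespace IsPartner

variable {V : Type*} {G : SimpleGraph V} {s : Set V} {p : V → V}

lemma apply_apply (h : IsPartner G s p) (v : V) : p (p v) = v :=
  (h.eq (p v) v (h.adj v).symm (by have := h.mem_iff v; tauto)).symm

lemma compl (h : IsPartner G s p) : IsPartner G sᶜ p where
  adj := h.adj
  mem_iff v := by have := h.mem_iff v; simp only [Set.mem_compl_iff]; tauto
  eq v w h1 h2 := h.eq v w h1 (by simp only [Set.mem_compl_iff] at h2; tauto)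

lemma isMatchingCut (h : IsPartner G s p) : IsMatchingCut G s := fun v =>
  ⟨p v, ⟨h.adj v, h.mem_iff v⟩, fun w hw => h.eq v w hw.1 hw.2⟩

/-- The only neighbour of `p a` in `s` is `a`, so `p a` prolongs an induced `P₄` starting at `a`. -/
lemma pathFourFree (h : IsPartner G s p) (hG : IsInducedFree (SimpleGraph.pathGraph 5) G) :
    PathFourFree (G.induce s) := by
  rintro ⟨a, ha⟩ ⟨b, hb⟩ ⟨c, hc⟩ ⟨d, hd⟩ hab hbc hcd hac had hbd
  simp only [SimpleGraph.induce_adj] at *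
  have key : ∀ x ∈ s, x ≠ a → ¬G.Adj (p a) x := by
    intro x hx hxa hadj
    apply hxa
    rw [h.eq (p a) x hadj (by have := h.mem_iff a; tauto), h.apply_apply]
  refine hG.not_pathFive (p a) a b c d (h.adj a).symm hab hbc hcd (key b hb hab.ne')
    (key c hc ?_) (key d hd ?_) hac had hbd
  · rintro rfl; exact had hcd
  · rintro rfl; exact hac hcd.symm

/-- Otherwise `p x, x, y, p y, z` is an induced `P₅`; the matching excludes the chords across the
cut. -/
lemma twin (h : IsPartner G s p) (hG : IsInducedFree (SimpleGraph.pathGraph 5) G) {x y z : V}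
    (hx : x ∈ s) (hy : y ∈ s) (hz : z ∉ s) (hxy : G.Adj x y) (hp : ¬G.Adj (p x) (p y))
    (hyz : G.Adj (p y) z) : G.Adj (p x) z := by
  by_contra hxz
  have hpx := (h.mem_iff x).1 hx
  have hpy := (h.mem_iff y).1 hy
  refine hG.not_pathFive (p x) x y (p y) z (h.adj x).symm hxy (h.adj y) hyz ?_ hp hxz ?_ ?_ ?_
  · intro hh
    have := h.eq (p x) y hh (by tauto)
    rw [h.apply_apply] at this
    exact hxy.ne this.symm
  · intro hh
    have := h.eq x (p y) hh (by tauto)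
    have := congrArg p this
    rw [h.apply_apply, h.apply_apply] at this
    exact hxy.ne this.symm
  · intro hh
    rw [h.eq x z hh (by tauto)] at hyz
    exact hp hyz.symm
  · intro hh
    rw [h.eq y z hh (by tauto)] at hyz
    exact hyz.ne rfl

/-- The set `t` is a variable so that the sides can be exchanged without meeting a double
complement. -/
lemma clique_of_isSplit (h : IsPartner G s p) (hG : IsInducedFree (SimpleGraph.pathGraph 5) G)
    {t : Set V} (ht : t = sᶜ) (e : G.induce t ≃g (G.induce s)ᶜ) {S : Set s}
    (hS : IsSplit (G.induce s)ᶜ Set.univ S) :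
    (∀ x ∈ s, ∀ y ∈ s, x ≠ y → G.Adj x y) ∧ ∀ x ∈ t, ∀ y ∈ t, ¬G.Adj x y := by
  subst ht
  -- Pulling `G[sᶜ]` back along the matching puts both graphs on the vertex set `s`.
  let q : s → (sᶜ : Set V) := fun x => ⟨p x, (h.mem_iff x).1 x.2⟩
  have hq : Function.Surjective q := fun y =>
    ⟨⟨p y, not_not.1 ((h.compl.mem_iff y).1 y.2)⟩, Subtype.ext (h.apply_apply y)⟩
  have hR := (hS.preimage e e.surjective).preimage q hq
  have hB : ((G.induce s)ᶜ.comap e).comap q = (G.induce sᶜ).comap q := by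
    congr 1
    ext x y
    exact e.map_adj_iff
  rw [hB] at hR
  have hno := not_adj_of_isSplit hS hR fun i j k hij hij' hjk =>
    h.twin hG i.2 j.2 (q k).2 hij hij' hjk
  have hB' : ∀ x y, ¬(G.induce sᶜ).Adj x y := by
    intro x y
    obtain ⟨i, rfl⟩ := hq x
    obtain ⟨j, rfl⟩ := hq y
    exact hno i j
  refine ⟨fun x hx y hy hxy => ?_, fun x hx y hy => hB' ⟨x, hx⟩ ⟨y, hy⟩⟩
  by_contra hn
  apply hB' (e.symm ⟨x, hx⟩) (e.symm ⟨y, hy⟩)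
  rw [e.symm.map_adj_iff, SimpleGraph.compl_adj]
  exact ⟨fun hh => hxy (congrArg Subtype.val hh), hn⟩

end IsPartner

/-- The isomorphism between the complements of isomorphic graphs, read backwards. -/
def complIsoSymm {α β : Type*} {A : SimpleGraph α} {B : SimpleGraph β} (e : B ≃g Aᶜ) : A ≃g Bᶜ where
  toEquiv := e.toEquiv.symm
  map_rel_iff' {x y} := by
    have : B.Adj (e.symm x) (e.symm y) ↔ Aᶜ.Adj x y := e.symm.map_adj_iff
    change Bᶜ.Adj (e.symm x) (e.symm y) ↔ _
    rw [SimpleGraph.compl_adj, this, SimpleGraph.compl_adj, e.symm.injective.ne_iff]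
    have : A.Adj x y → x ≠ y := fun h => h.ne
    tauto

/-- A `P₅`-free yes-instance is a complete graph and an edgeless graph joined by a perfect
matching. -/
theorem CompSubPM.exists_clique {V : Type*} [Finite V] {G : SimpleGraph V}
    (hG : IsInducedFree (SimpleGraph.pathGraph 5) G) (h : CompSubPM G) :
    ∃ s, (∀ x ∈ s, ∀ y ∈ s, x ≠ y → G.Adj x y) ∧ (∀ x ∉ s, ∀ y ∉ s, ¬G.Adj x y) ∧
      IsMatchingCut G s := by
  classical
  obtain ⟨s, H, ⟨e₁⟩, ⟨e₂⟩, hM⟩ := h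
  rw [edgeCut_isPerfectMatching_iff] at hM
  obtain ⟨p, hp⟩ := hM.exists_isPartner
  have e' : G.induce s ≃g (G.induce sᶜ)ᶜ := e₁.trans (complIsoSymm e₂)
  have e : G.induce sᶜ ≃g (G.induce s)ᶜ := complIsoSymm e'
  have : Fintype s := Fintype.ofFinite s
  by_cases hs : 1 < (Finset.univ : Finset s).card
  · obtain ⟨R, hR⟩ := (hp.pathFourFree hG).exists_isSplit Finset.univ hs
    rw [Finset.coe_univ] at hR
    rcases hR with hR | hR
    · have hR' := hR.preimage e'.symm e'.symm.surjective
      have hcomap : (G.induce s).comap e'.symm = (G.induce sᶜ)ᶜ := by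
        ext x y
        exact e'.symm.map_adj_iff
      rw [hcomap] at hR'
      obtain ⟨h1, h2⟩ := hp.compl.clique_of_isSplit hG (compl_compl s).symm e' hR'
      exact ⟨sᶜ, h1, fun x hx y hy => h2 x (not_not.1 hx) y (not_not.1 hy),
        hp.compl.isMatchingCut⟩
    · obtain ⟨h1, h2⟩ := hp.clique_of_isSplit hG rfl e hR
      exact ⟨s, h1, h2, hM⟩
  · have hsub : Subsingleton s := Fintype.card_le_one_iff_subsingleton.1 (by simpa using hs)
    have hsub' : Subsingleton (sᶜ : Set V) := e.toEquiv.subsingleton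
    refine ⟨s, fun x hx y hy hxy => (hxy (congrArg Subtype.val
      (hsub.elim ⟨x, hx⟩ ⟨y, hy⟩))).elim, fun x hx y hy hxy => ?_, hM⟩
    exact hxy.ne (congrArg Subtype.val (hsub'.elim ⟨x, hx⟩ ⟨y, hy⟩))

/-! ### The degree criterion -/

open Classical in
/-- Every vertex is a leaf or adjacent to half of the vertices, and there are as many vertices of
either kind. -/
def LeafHalfBalanced {N : ℕ} (G : SimpleGraph (Fin N)) : Prop :=
  (∀ v, G.degree v = 1 ∨ 2 * G.degree v = N) ∧
    ({v | G.degree v = 1} : Finset (Fin N)).card = ({v | 2 * G.degree v = N} : Finset (Fin N)).card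

open Classical in
lemma IsMatchingCut.leafHalfBalanced {N : ℕ} {G : SimpleGraph (Fin N)} {s : Set (Fin N)}
    (hs : ∀ x ∈ s, ∀ y ∈ s, x ≠ y → G.Adj x y) (hs' : ∀ x ∉ s, ∀ y ∉ s, ¬G.Adj x y)
    (hM : IsMatchingCut G s) : LeafHalfBalanced G := by
  obtain ⟨p, hp⟩ := hM.exists_isPartner
  set S : Finset (Fin N) := {v | v ∈ s} with hS
  have hmem : ∀ v, v ∈ S ↔ v ∈ s := by simp [hS]
  have hcard : Sᶜ.card = S.card := by
    refine Finset.card_bij' (fun v _ => p v) (fun v _ => p v) ?_ ?_ ?_ ?_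
    · intro v hv
      have := hp.mem_iff v
      rw [Finset.mem_compl, hmem] at hv
      rw [hmem]; tauto
    · intro v hv
      have := hp.mem_iff v
      rw [hmem] at hv
      rw [Finset.mem_compl, hmem]; tauto
    · intro v _; exact hp.apply_apply v
    · intro v _; exact hp.apply_apply v
  have hN : N = 2 * S.card := by
    have := S.card_compl_add_card
    rw [Fintype.card_fin] at this
    omega
  have hin : ∀ v ∈ S, G.degree v = S.card := by
    intro v hv
    have hv' := (hmem v).1 hv
    have : G.neighborFinset v = insert (p v) (S.erase v) := by
      ext w
      rw [SimpleGraph.mem_neighborFinset, Finset.mem_insert, Finset.mem_erase, hmem]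
      constructor
      · intro hvw
        by_cases hw : w ∈ s
        · exact .inr ⟨hvw.ne', hw⟩
        · exact .inl (hp.eq v w hvw (by tauto))
      · rintro (rfl | ⟨h1, h2⟩)
        · exact hp.adj v
        · exact hs v hv' w h2 h1.symm
    rw [← SimpleGraph.card_neighborFinset_eq_degree, this, Finset.card_insert_of_notMem,
      Finset.card_erase_add_one hv]
    rw [Finset.mem_erase, hmem]
    exact fun hh => (hp.mem_iff v).1 hv' hh.2
  have hout : ∀ v ∉ S, G.degree v = 1 := by
    intro v hv
    rw [hmem] at hv
    rw [← SimpleGraph.card_neighborFinset_eq_degree, Finset.card_eq_one]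
    refine ⟨p v, ?_⟩
    ext w
    rw [SimpleGraph.mem_neighborFinset, Finset.mem_singleton]
    constructor
    · intro hvw
      exact hp.eq v w hvw (by have := hs' v hv w; tauto)
    · rintro rfl
      exact hp.adj v
  refine ⟨fun v => ?_, ?_⟩
  · by_cases hv : v ∈ S
    · right; rw [hin v hv, ← hN]
    · exact .inl (hout v hv)
  -- For `N = 2` the two kinds of vertices coincide.
  · by_cases h1 : S.card = 1
    · have hall : ∀ v, G.degree v = 1 := fun v => by
        by_cases hv : v ∈ S
        · rw [hin v hv, h1]
        · exact hout v hv
      simp [hall, hN, h1]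
    · have e1 : ({v | G.degree v = 1} : Finset (Fin N)) = Sᶜ := by
        ext v
        rw [Finset.mem_filter_univ, Finset.mem_compl]
        exact ⟨fun h hv => h1 (by rw [← hin v hv, h]), hout v⟩
      have e2 : ({v | 2 * G.degree v = N} : Finset (Fin N)) = S := by
        ext v
        rw [Finset.mem_filter_univ]
        refine ⟨fun h => ?_, fun hv => by rw [hin v hv, ← hN]⟩
        by_contra hv
        have := hout v hv
        omega
      rw [e1, e2, hcard]

/-- Any bijection from an independent set to a clique is an isomorphism onto the complement. -/
lemma compSubPM_of_clique {V : Type*} [Fintype V] {G : SimpleGraph V} {S : Finset V}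
    (hcard : Fintype.card V = 2 * S.card)
    (hs : ∀ x ∈ S, ∀ y ∈ S, x ≠ y → G.Adj x y) (hs' : ∀ x ∉ S, ∀ y ∉ S, ¬G.Adj x y)
    (hM : IsMatchingCut G S) : CompSubPM G := by
  classical
  refine ⟨S, G.induce S, ⟨SimpleGraph.Iso.refl⟩, ?_, edgeCut_isPerfectMatching_iff.2 hM⟩
  have e : ((S : Set V)ᶜ : Set V) ≃ (S : Set V) := by
    refine Fintype.equivOfCardEq ?_
    have : Fintype.card (S : Set V) = S.card := by simp
    rw [Fintype.card_compl_set, this, hcard]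
    omega
  refine ⟨⟨e, fun {x y} => ?_⟩⟩
  have h1 := hs _ (e x).2 _ (e y).2
  have h2 := hs' x.1 x.2 y.1 y.2
  simp only [SimpleGraph.compl_adj, SimpleGraph.induce_adj]
  have : (e x : V) ≠ e y ↔ e x ≠ e y := Subtype.coe_injective.ne_iff
  tauto

open Classical in
-- Let `S` be the vertices of degree `N / 2`. For `N ≠ 2` they are half of all vertices, so each has
-- at most `N / 2 - 1` neighbours in `S` and at least one outside, while each leaf has at most one
-- neighbour in `S`. Counting the edges across forces equality everywhere.
lemma LeafHalfBalanced.compSubPM {N : ℕ} {G : SimpleGraph (Fin N)} (h : LeafHalfBalanced G) :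
    CompSubPM G := by
  obtain ⟨hdeg, hcard⟩ := h
  by_cases hN : N = 2
  · subst hN
    have hd : ∀ v, G.degree v = 1 := fun v => by have := hdeg v; omega
    have h01 : G.Adj 0 1 := by
      have hpos : 0 < G.degree 0 := by rw [hd]; norm_num
      obtain ⟨w, hw⟩ := (G.degree_pos_iff_exists_adj 0).1 hpos
      fin_cases w
      · exact (hw.ne rfl).elim
      · exact hw
    refine compSubPM_of_clique (S := {0}) (by simp) ?_ ?_ ?_
    · intro x hx y hy hxy
      exact (hxy (by rw [Finset.mem_singleton.1 hx, Finset.mem_singleton.1 hy])).elim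
    · intro x hx y hy
      have : x = y := by revert x y; decide
      subst this; exact G.loopless.irrefl x
    · intro v
      fin_cases v
      · exact ⟨1, ⟨h01, by simp⟩, fun w hw => by fin_cases w <;> simp_all⟩
      · exact ⟨0, ⟨h01.symm, by simp⟩, fun w hw => by fin_cases w <;> simp_all⟩
  · set S : Finset (Fin N) := {v | 2 * G.degree v = N} with hS
    have hmem : ∀ v, v ∈ S ↔ 2 * G.degree v = N := by simp [hS]
    have hout : ∀ v ∈ Sᶜ, G.degree v = 1 := fun v hv =>
      (hdeg v).resolve_right (by rwa [Finset.mem_compl, hmem] at hv)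
    have hcompl : ({v | G.degree v = 1} : Finset (Fin N)) = Sᶜ := by
      ext v
      rw [Finset.mem_filter_univ]
      refine ⟨fun h1 => ?_, hout v⟩
      rw [Finset.mem_compl, hmem]
      omega
    rw [hcompl] at hcard
    have hNS : N = 2 * S.card := by
      have := S.card_compl_add_card
      rw [Fintype.card_fin] at this
      omega
    have hin : ∀ v ∈ S, G.degree v = S.card := fun v hv => by
      have := (hmem v).1 hv
      omega
    have hsplit : ∀ v, (G.neighborFinset v ∩ S).card + (G.neighborFinset v ∩ Sᶜ).card =
        G.degree v := by
      intro v
      rw [← SimpleGraph.card_neighborFinset_eq_degree, ← Finset.sdiff_eq_inter_compl]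
      exact Finset.card_inter_add_card_sdiff _ _
    have hle : ∀ v ∈ S, (G.neighborFinset v ∩ S).card ≤ (S.erase v).card := by
      intro v hv
      refine Finset.card_le_card fun w hw => ?_
      rw [Finset.mem_inter, SimpleGraph.mem_neighborFinset] at hw
      exact Finset.mem_erase.2 ⟨hw.1.ne', hw.2⟩
    have hge : ∀ v ∈ S, 1 ≤ (G.neighborFinset v ∩ Sᶜ).card := by
      intro v hv
      have h1 := hsplit v
      have h2 := hle v hv
      have h3 := Finset.card_erase_add_one hv
      have h4 := hin v hv
      omega
    have hout' : ∀ v ∈ Sᶜ, (G.neighborFinset v ∩ S).card ≤ 1 := by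
      intro v hv
      have h1 := hsplit v
      have h2 := hout v hv
      omega
    have hdouble : ∑ v ∈ S, (G.neighborFinset v ∩ Sᶜ).card =
        ∑ v ∈ Sᶜ, (G.neighborFinset v ∩ S).card := by
      have := Finset.sum_card_bipartiteAbove_eq_sum_card_bipartiteBelow (s := S) (t := Sᶜ) G.Adj
      convert this using 3 with v hv v hv
      · ext w; simp [Finset.bipartiteAbove, and_comm]
      · ext w; simp [Finset.bipartiteBelow, and_comm, G.adj_comm]
    have hsum1 : ∑ v ∈ S, 1 ≤ ∑ v ∈ S, (G.neighborFinset v ∩ Sᶜ).card := Finset.sum_le_sum hge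
    have hsum2 : ∑ v ∈ Sᶜ, (G.neighborFinset v ∩ S).card ≤ ∑ v ∈ Sᶜ, 1 :=
      Finset.sum_le_sum hout'
    simp only [Finset.sum_const, smul_eq_mul, mul_one] at hsum1 hsum2
    have heq1 : ∀ v ∈ S, (G.neighborFinset v ∩ Sᶜ).card = 1 := by
      have := (Finset.sum_eq_sum_iff_of_le hge).1 (by simp; omega)
      exact fun v hv => (this v hv).symm
    have heq2 : ∀ v ∈ Sᶜ, (G.neighborFinset v ∩ S).card = 1 :=
      (Finset.sum_eq_sum_iff_of_le hout').1 (by simp; omega)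
    refine compSubPM_of_clique (S := S) (by rwa [Fintype.card_fin]) ?_ ?_ ?_
    · intro x hx y hy hxy
      have h1 := hsplit x
      have h2 := heq1 x hx
      have h3 := hin x hx
      have h4 := Finset.card_erase_add_one hx
      have : G.neighborFinset x ∩ S = S.erase x := by
        refine Finset.eq_of_subset_of_card_le (fun w hw => ?_) (by omega)
        rw [Finset.mem_inter, SimpleGraph.mem_neighborFinset] at hw
        exact Finset.mem_erase.2 ⟨hw.1.ne', hw.2⟩
      have hy' : y ∈ G.neighborFinset x ∩ S := by
        rw [this]; exact Finset.mem_erase.2 ⟨hxy.symm, hy⟩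
      exact (SimpleGraph.mem_neighborFinset _ _ _).1 (Finset.mem_inter.1 hy').1
    · intro x hx y hy hxy
      have hx' := Finset.mem_compl.2 hx
      have h1 := hsplit x
      have h2 := heq2 x hx'
      have h3 := hout x hx'
      have : (G.neighborFinset x ∩ Sᶜ).card = 0 := by omega
      rw [Finset.card_eq_zero] at this
      have hy' : y ∈ G.neighborFinset x ∩ Sᶜ := by simp [hxy, hy]
      simp [this] at hy'
    · intro v
      by_cases hv : v ∈ S
      · obtain ⟨w, hw⟩ := Finset.card_eq_one.1 (heq1 v hv)
        refine ⟨w, ?_, fun u hu => ?_⟩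
        · have : w ∈ G.neighborFinset v ∩ Sᶜ := by simp [hw]
          simp only [Finset.mem_inter, SimpleGraph.mem_neighborFinset, Finset.mem_compl] at this
          simp [this, hv]
        · have : u ∈ G.neighborFinset v ∩ Sᶜ := by
            simp only [Finset.mem_coe] at hu
            simp [hu.1, hu.2.1 hv]
          simpa [hw] using this
      · obtain ⟨w, hw⟩ := Finset.card_eq_one.1 (heq2 v (Finset.mem_compl.2 hv))
        refine ⟨w, ?_, fun u hu => ?_⟩
        · have : w ∈ G.neighborFinset v ∩ S := by simp [hw]
          simp only [Finset.mem_inter, SimpleGraph.mem_neighborFinset] at this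
          simp [this, hv]
        · have : u ∈ G.neighborFinset v ∩ S := by
            simp only [Finset.mem_coe] at hu
            simp only [Finset.mem_inter, SimpleGraph.mem_neighborFinset]
            tauto
          simpa [hw] using this

/-- On `P₅`-free graphs, the yes-instances are recognized by their degrees. -/
theorem compSubPM_iff_leafHalfBalanced {N : ℕ} {G : SimpleGraph (Fin N)}
    (hG : IsInducedFree (SimpleGraph.pathGraph 5) G) : CompSubPM G ↔ LeafHalfBalanced G := by
  refine ⟨fun h => ?_, LeafHalfBalanced.compSubPM⟩
  obtain ⟨s, h1, h2, h3⟩ := h.exists_clique hG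
  exact h3.leafHalfBalanced h1 h2

/-! ### The machine -/

open Turing

namespace LeafHalf

/-- The stacks: the input, the counter of the current row, and the counter of the rows. -/
inductive Stack
  | input
  | row
  | rows
  deriving DecidableEq

instance : Fintype Stack := ⟨{.input, .row, .rows}, fun k => by cases k <;> decide⟩

/-- The alphabets of the stacks. -/
def Symb : Stack → Type
  | .input => Option Bool
  | .row => Bool
  | .rows => Bool

/-- The program labels. -/
inductive Label
  | read
  | clear
  | accept
  | reject
  deriving DecidableEq

instance : Fintype Label :=
  ⟨{.read, .clear, .accept, .reject}, fun l => by cases l <;> decide⟩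

/-- Registers: the number of ones read in the current row, capped at two, and one register for the
last letter read from every stack. -/
structure Reg where
  ones : Fin 3
  letter : Option (Option Bool)
  top : Option Bool
  rest : Option Bool
  deriving Fintype

/-- The registers with the letters erased. -/
def Reg.blank (c : Fin 3) : Reg := ⟨c, none, none, none⟩

/-- The next number of ones, capped at two. -/
def next (c : Fin 3) : Fin 3 := if c = 0 then 1 else 2

/-- Change the signed unary counter on the stack `k` by one, up or down according to `b`. -/
def count (k : Stack) (inj : Symb k ≃ Bool) (b : Reg → Bool)
    (q : TM2.Stmt Symb Label Reg) : TM2.Stmt Symb Label Reg :=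
  .peek k (fun v x => { v with top := x.map inj })
    (.branch (fun v => v.top == some !(b v)) (.pop k (fun v _ => v) q)
      (.push k (fun v => inj.symm (b v)) q))

/-- The program. -/
def program : Label → TM2.Stmt Symb Label Reg
  | .read =>
    .pop .input (fun v x => { v with letter := x })
      (.branch (fun v => v.letter == none) (.load (fun _ => .blank 0) (.goto fun _ => .accept))
      (.branch (fun v => v.letter == some none)
        (.peek .row (fun v x => { v with top := x })
          (.branch (fun v => v.ones == 1)
            -- A row of both kinds contributes `1 - 1 = 0`, so the counter of the rows is left
            -- alone.
            (.branch (fun v => v.top == none)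
              (.load (fun _ => .blank 0) (.goto fun _ => .read))
              (count .rows (.refl _) (fun _ => true)
                (.load (fun _ => .blank 0) (.goto fun _ => .clear))))
            (.branch (fun v => v.top == none)
              (count .rows (.refl _) (fun _ => false)
                (.load (fun _ => .blank 0) (.goto fun _ => .read)))
              (.load (fun _ => .blank 0) (.goto fun _ => .reject)))))
        (count .row (.refl _) (fun v => v.letter == some (some true))
          (.load (fun v => .blank (if v.letter == some (some true) then next v.ones else v.ones))
            (.goto fun _ => .read)))))
  | .clear =>
    .pop .row (fun v x => { v with top := x })
      (.branch (fun v => v.top == none)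
        (.load (fun _ => .blank 0) (.goto fun _ => .read))
        (.load (fun _ => .blank 0) (.goto fun _ => .clear)))
  | .accept =>
    .peek .rows (fun v x => { v with top := x })
      (.branch (fun v => v.top == none)
        (.push .row (fun _ => true) (.load (fun _ => .blank 0) .halt))
        (.load (fun _ => .blank 0) (.goto fun _ => .reject)))
  -- The halting configuration must hold nothing but the answer, so all stacks are emptied first.
  | .reject =>
    .pop .input (fun v x => { v with letter := x })
      (.pop .row (fun v x => { v with top := x })
        (.pop .rows (fun v x => { v with rest := x })
          (.branch (fun v => v.letter == none && v.top == none && v.rest == none)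
            (.push .row (fun _ => false) (.load (fun _ => .blank 0) .halt))
            (.load (fun _ => .blank 0) (.goto fun _ => .reject)))))

/-- The machine that decides whether the rows of a 0-1 matrix have a single one or as many ones as
zeros, as many rows being of either kind. -/
def machine : FinTM2 where
  K := Stack
  k₀ := .input
  k₁ := .row
  Γ := Symb
  Λ := Label
  main := .read
  σ := Reg
  initialState := .blank 0
  Γk₀Fin := inferInstanceAs (Fintype (Option Bool))
  m := program

/-- The contents of the stacks. -/
def contents (x : List (Option Bool)) (y z : List Bool) : ∀ k, List (Symb k)
  | .input => x
  | .row => y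
  | .rows => z

/-- The signed unary counter with value `k`. -/
def counter : ℤ → List Bool
  | .ofNat n => List.replicate n true
  | .negSucc n => List.replicate (n + 1) false

lemma length_counter (k : ℤ) : (counter k).length = k.natAbs := by
  cases k <;> simp [counter]

lemma counter_ne_nil {k : ℤ} (hk : k ≠ 0) : counter k ≠ [] := by
  rw [← List.length_pos_iff, length_counter]
  exact Int.natAbs_pos.2 hk

/-- The effect of `count` on a stack. -/
def bump (b : Bool) (l : List Bool) : List Bool := if l.head? = some !b then l.tail else b :: l

/-- The change of a counter. -/
def sign (b : Bool) : ℤ := if b then 1 else -1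

lemma bump_counter (b : Bool) (k : ℤ) : bump b (counter k) = counter (k + sign b) := by
  rcases k with n | n
  · cases b
    · cases n with
      | zero => rfl
      | succ n =>
        have : Int.ofNat (n + 1) + sign false = Int.ofNat n := by simp [sign]
        rw [this]; rfl
    · cases n <;> rfl
  · cases b
    · rfl
    · cases n with
      | zero => rfl
      | succ n =>
        have : Int.negSucc (n + 1) + sign true = Int.negSucc n := by simp [sign]; omega
        rw [this]; rfl

/-- A configuration of the machine. -/
def cfg (l : Option Label) (c : Fin 3) (x : List (Option Bool)) (y z : List Bool) : machine.Cfg :=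
  (⟨l, .blank c, contents x y z⟩ : TM2.Cfg Symb Label Reg)

/-- Comparing the result field by field and stack by stack lets each transition below be checked by
`rfl`. -/
lemma step_cfg {l : Label} {l' : Option Label} {c c' : Fin 3} {x x' : List (Option Bool)}
    {y y' z z' : List Bool} (C : TM2.Cfg Symb Label Reg)
    (hC : C = TM2.stepAux (program l) (.blank c) (contents x y z))
    (hl : C.l = l') (hc : C.var = .blank c') (hx : C.stk .input = x') (hy : C.stk .row = y')
    (hz : C.stk .rows = z') :
    machine.step (cfg (some l) c x y z) = some (cfg l' c' x' y' z') := by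
  have : C = cfg l' c' x' y' z' := by
    rcases C with ⟨l₀, v, S⟩
    subst hl hc hx hy hz
    simp only [cfg, TM2.Cfg.mk.injEq, true_and]
    funext k
    cases k <;> rfl
  rw [← this, hC]
  rfl

/-- `a` evolves to `b` in at most `n` steps. -/
def Runs (a b : machine.Cfg) (n : ℕ) : Prop :=
  Nonempty (StateTransition.EvalsToInTime machine.step a (some b) n)

lemma Runs.refl (a : machine.Cfg) : Runs a a 0 := ⟨.refl _ _⟩

lemma Runs.trans {a b c : machine.Cfg} {m n : ℕ} (h : Runs a b m) (h' : Runs b c n) :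
    Runs a c (m + n) := by
  obtain ⟨h⟩ := h
  obtain ⟨h'⟩ := h'
  have := h.trans _ _ _ _ _ _ h'
  rw [add_comm] at this
  exact ⟨this⟩

lemma Runs.mono {a b : machine.Cfg} {m n : ℕ} (h : Runs a b m) (hmn : m ≤ n) : Runs a b n := by
  obtain ⟨h⟩ := h
  exact ⟨⟨h.toEvalsTo, h.steps_le_m.trans hmn⟩⟩

lemma Runs.of_step {a b : machine.Cfg} (h : machine.step a = some b) : Runs a b 1 :=
  ⟨⟨⟨1, h⟩, le_rfl⟩⟩

lemma step_read_bit (c : Fin 3) (b : Bool) (x : List (Option Bool)) (y z : List Bool) :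
    machine.step (cfg (some .read) c (some b :: x) y z) =
      some (cfg (some .read) (if b then next c else c) x (bump b y) z) := by
  rcases y with _ | ⟨a, y⟩
  · cases b <;> exact step_cfg _ rfl rfl rfl rfl rfl rfl
  · cases a <;> cases b <;> exact step_cfg _ rfl rfl rfl rfl rfl rfl

lemma step_read_nil (c : Fin 3) (y z : List Bool) :
    machine.step (cfg (some .read) c [] y z) = some (cfg (some .accept) 0 [] y z) := by
  exact step_cfg _ rfl rfl rfl rfl rfl rfl

lemma step_read_both (x : List (Option Bool)) (z : List Bool) :
    machine.step (cfg (some .read) 1 (none :: x) [] z) = some (cfg (some .read) 0 x [] z) := by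
  exact step_cfg _ rfl rfl rfl rfl rfl rfl

lemma step_read_leaf (x : List (Option Bool)) {y : List Bool} (hy : y ≠ []) (z : List Bool) :
    machine.step (cfg (some .read) 1 (none :: x) y z) =
      some (cfg (some .clear) 0 x y (bump true z)) := by
  obtain ⟨a, y, rfl⟩ := List.exists_cons_of_ne_nil hy
  rcases z with _ | ⟨b, z⟩
  · exact step_cfg _ rfl rfl rfl rfl rfl rfl
  · cases b <;> exact step_cfg _ rfl rfl rfl rfl rfl rfl

lemma step_read_half {c : Fin 3} (hc : c ≠ 1) (x : List (Option Bool)) (z : List Bool) :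
    machine.step (cfg (some .read) c (none :: x) [] z) =
      some (cfg (some .read) 0 x [] (bump false z)) := by
  rcases z with _ | ⟨b, z⟩
  · fin_cases c <;> first | exact (hc rfl).elim | exact step_cfg _ rfl rfl rfl rfl rfl rfl
  · cases b <;> fin_cases c <;> first | exact (hc rfl).elim | exact step_cfg _ rfl rfl rfl rfl rfl rfl

lemma step_read_neither {c : Fin 3} (hc : c ≠ 1) (x : List (Option Bool)) {y : List Bool}
    (hy : y ≠ []) (z : List Bool) :
    machine.step (cfg (some .read) c (none :: x) y z) = some (cfg (some .reject) 0 x y z) := by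
  obtain ⟨a, y, rfl⟩ := List.exists_cons_of_ne_nil hy
  fin_cases c <;> first | exact (hc rfl).elim | exact step_cfg _ rfl rfl rfl rfl rfl rfl

lemma step_clear_nil (x : List (Option Bool)) (z : List Bool) :
    machine.step (cfg (some .clear) 0 x [] z) = some (cfg (some .read) 0 x [] z) := by
  exact step_cfg _ rfl rfl rfl rfl rfl rfl

lemma step_clear_cons (x : List (Option Bool)) (a : Bool) (y z : List Bool) :
    machine.step (cfg (some .clear) 0 x (a :: y) z) = some (cfg (some .clear) 0 x y z) := by
  exact step_cfg _ rfl rfl rfl rfl rfl rfl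

lemma step_accept_nil :
    machine.step (cfg (some .accept) 0 [] [] []) = some (cfg none 0 [] [true] []) := by
  exact step_cfg _ rfl rfl rfl rfl rfl rfl

lemma step_accept_ne_nil {z : List Bool} (hz : z ≠ []) :
    machine.step (cfg (some .accept) 0 [] [] z) = some (cfg (some .reject) 0 [] [] z) := by
  obtain ⟨a, z, rfl⟩ := List.exists_cons_of_ne_nil hz
  exact step_cfg _ rfl rfl rfl rfl rfl rfl

lemma step_reject (x : List (Option Bool)) (y z : List Bool) :
    machine.step (cfg (some .reject) 0 x y z) =
      some (if x = [] ∧ y = [] ∧ z = [] then cfg none 0 [] [false] []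
        else cfg (some .reject) 0 x.tail y.tail z.tail) := by
  cases x <;> cases y <;> cases z <;> exact step_cfg _ rfl rfl rfl rfl rfl rfl

/-! ### Running times and correctness of the runs -/

lemma runs_reject (n : ℕ) : ∀ (x : List (Option Bool)) (y z : List Bool), x.length ≤ n →
    y.length ≤ n → z.length ≤ n →
    Runs (cfg (some .reject) 0 x y z) (cfg none 0 [] [false] []) (n + 1) := by
  induction n with
  | zero =>
    intro x y z hx hy hz
    refine .of_step ?_
    rw [step_reject, if_pos]
    simpa using And.intro hx (And.intro hy hz)
  | succ n ih =>
    intro x y z hx hy hz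
    by_cases h : x = [] ∧ y = [] ∧ z = []
    · refine Runs.mono (.of_step ?_) (Nat.le_add_left 1 _)
      rw [step_reject, if_pos h]
    · have h1 := Runs.of_step (step_reject x y z)
      rw [if_neg h] at h1
      refine (h1.trans (ih _ _ _ ?_ ?_ ?_)).mono (by omega) <;>
        (rw [List.length_tail]; omega)

lemma runs_clear (x : List (Option Bool)) (y z : List Bool) :
    Runs (cfg (some .clear) 0 x y z) (cfg (some .read) 0 x [] z) (y.length + 1) := by
  induction y with
  | nil => exact .of_step (step_clear_nil x z)
  | cons a y ih =>
    exact ((Runs.of_step (step_clear_cons x a y z)).trans ih).mono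
      (by rw [List.length_cons]; omega)

/-- The number `n`, capped at two. -/
def cap (n : ℕ) : Fin 3 := ⟨min n 2, by omega⟩

lemma next_cap (n : ℕ) : next (cap n) = cap (n + 1) := by
  rcases n with _ | n
  · rfl
  · have h1 : cap (n + 1) ≠ 0 := by simp [cap, Fin.ext_iff]
    rw [next, if_neg h1]
    simp [cap]

lemma cap_eq_one_iff (n : ℕ) : cap n = 1 ↔ n = 1 := by
  simp [cap, Fin.ext_iff]; omega

/-- The number of ones minus the number of zeros. -/
def excess (r : List Bool) : ℤ := (r.map sign).sum

lemma natAbs_excess_le (r : List Bool) : (excess r).natAbs ≤ r.length := by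
  induction r with
  | nil => simp [excess]
  | cons b r ih =>
    have : excess (b :: r) = sign b + excess r := by simp [excess]
    have h2 : (sign b).natAbs = 1 := by cases b <;> rfl
    rw [this, List.length_cons]
    omega

lemma excess_eq (r : List Bool) : excess r = 2 * r.count true - r.length := by
  induction r with
  | nil => simp [excess]
  | cons b r ih =>
    have : excess (b :: r) = sign b + excess r := by simp [excess]
    rw [this, ih]
    cases b <;> simp [sign] <;> ring

lemma runs_read_row (r : List Bool) (x : List (Option Bool)) (z : List Bool) :
    ∀ (n : ℕ) (k : ℤ), Runs (cfg (some .read) (cap n) (r.map some ++ x) (counter k) z)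
      (cfg (some .read) (cap (n + r.count true)) x (counter (k + excess r)) z) r.length := by
  induction r with
  | nil => intro n k; simpa [excess] using Runs.refl _
  | cons b r ih =>
    intro n k
    have h1 := Runs.of_step (step_read_bit (cap n) b (r.map some ++ x) (counter k) z)
    rw [bump_counter, next_cap] at h1
    have h2 : (if b then cap (n + 1) else cap n) = cap (n + [b].count true) := by
      cases b <;> rfl
    rw [h2] at h1
    have h3 := h1.trans (ih _ _)
    have h4 : k + excess (b :: r) = k + sign b + excess r := by simp [excess, add_assoc]
    have h5 : n + (b :: r).count true = n + [b].count true + r.count true := by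
      rw [← List.singleton_append, List.count_append, add_assoc]
    rw [h4, h5]
    exact h3.mono (by rw [List.length_cons]; omega)

/-- A row with a single one. -/
def IsLeafRow (r : List Bool) : Prop := r.count true = 1

/-- A row with as many ones as zeros. -/
def IsHalfRow (r : List Bool) : Prop := excess r = 0

instance : DecidablePred IsLeafRow := fun r => inferInstanceAs (Decidable (r.count true = 1))

instance : DecidablePred IsHalfRow := fun r => inferInstanceAs (Decidable (excess r = 0))

/-- The letters of a 0-1 matrix, row by row. -/
def text (rs : List (List Bool)) : List (Option Bool) :=
  rs.flatMap fun r => r.map some ++ [none]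

/-- The matrix is accepted, if the rows before it contribute `k`. -/
def Accepts (k : ℤ) (rs : List (List Bool)) : Prop :=
  (∀ r ∈ rs, IsLeafRow r ∨ IsHalfRow r) ∧ k + rs.countP IsLeafRow = rs.countP IsHalfRow

instance (k : ℤ) (rs : List (List Bool)) : Decidable (Accepts k rs) :=
  inferInstanceAs (Decidable (_ ∧ _))

lemma accepts_cons (k : ℤ) (r : List Bool) (rs : List (List Bool)) :
    Accepts k (r :: rs) ↔ (IsLeafRow r ∨ IsHalfRow r) ∧
      Accepts (k + (if IsLeafRow r then 1 else 0) - (if IsHalfRow r then 1 else 0)) rs := by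
  simp only [Accepts, List.forall_mem_cons, and_assoc, List.countP_cons, decide_eq_true_eq]
  refine and_congr_right fun _ => and_congr_right fun _ => ?_
  split_ifs <;> push_cast <;> constructor <;> intro h <;> linarith

/-- A row of length `m` costs at most `m + 1` steps to read and, for a leaf row, `m + 1` more to
clear the counter; `k` moves by at most one. This fits in `3 * (m + 1)`. The final `3` pays for
leaving `read`, leaving `accept` and the last step of `reject`. -/
lemma runs_read_text (rs : List (List Bool)) : ∀ k : ℤ,
    Runs (cfg (some .read) 0 (text rs) [] (counter k))
      (cfg none 0 [] [decide (Accepts k rs)] []) (3 * (text rs).length + k.natAbs + 3) := by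
  induction rs with
  | nil =>
    intro k
    have h1 := Runs.of_step (step_read_nil 0 [] (counter k))
    by_cases hk : k = 0
    · subst hk
      exact (h1.trans (.of_step step_accept_nil)).mono (by omega)
    · have h2 := h1.trans (.of_step (step_accept_ne_nil (counter_ne_nil hk)))
      have h3 := h2.trans (runs_reject k.natAbs [] [] (counter k) (by simp) (by simp)
        (by rw [length_counter]))
      have : ¬Accepts k [] := by simpa [Accepts] using hk
      rw [decide_eq_false this]
      exact h3.mono (by omega)
  | cons r rs ih =>
    intro k
    have htext : text (r :: rs) = r.map some ++ none :: text rs := by simp [text]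
    have hlen : (text (r :: rs)).length = r.length + 1 + (text rs).length := by
      rw [htext]; simp; omega
    have hread := runs_read_row r (none :: text rs) (counter k) 0 0
    rw [← htext, zero_add, zero_add] at hread
    have habs := natAbs_excess_le r
    by_cases h1 : IsLeafRow r <;> by_cases h2 : IsHalfRow r
    · have hacc : Accepts k (r :: rs) ↔ Accepts k rs := by
        rw [accepts_cons, if_pos h1, if_pos h2]; simp [h1]
      rw [show r.count true = 1 from h1, show excess r = 0 from h2] at hread
      have h3 := (hread.trans (.of_step (step_read_both (text rs) (counter k)))).trans (ih k)
      simp only [hacc]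
      exact h3.mono (by omega)
    · have hacc : Accepts k (r :: rs) ↔ Accepts (k + sign true) rs := by
        rw [accepts_cons, if_pos h1, if_neg h2]; simp [h1, sign]
      rw [show r.count true = 1 from h1] at hread
      have h3 := Runs.of_step (step_read_leaf (text rs) (counter_ne_nil h2) (counter k))
      have h4 := ((hread.trans h3).trans (runs_clear _ _ _))
      rw [bump_counter, length_counter] at h4
      have h5 := h4.trans (ih _)
      simp only [hacc]
      exact h5.mono (by simp only [sign, if_true]; omega)
    · have hacc : Accepts k (r :: rs) ↔ Accepts (k + sign false) rs := by
        rw [accepts_cons, if_neg h1, if_pos h2]; simp [h2, sign, sub_eq_add_neg]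
      rw [show excess r = 0 from h2] at hread
      have h3 := Runs.of_step (step_read_half (mt (cap_eq_one_iff _).1 h1) (text rs) (counter k))
      rw [bump_counter] at h3
      have h5 := (hread.trans h3).trans (ih _)
      simp only [hacc]
      exact h5.mono (by simp [sign]; omega)
    · have hacc : ¬Accepts k (r :: rs) := by
        rw [accepts_cons]; tauto
      have h3 := Runs.of_step (step_read_neither (mt (cap_eq_one_iff _).1 h1) (text rs)
        (counter_ne_nil h2) (counter k))
      have h4 := (hread.trans h3).trans (runs_reject ((text rs).length + r.length + k.natAbs)
        _ _ _ (by omega) (by rw [length_counter]; omega) (by rw [length_counter]; omega))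
      rw [decide_eq_false hacc]
      exact h4.mono (by omega)

end LeafHalf

/-! ### From adjacency matrices to the machine -/

namespace LeafHalf

lemma initList_machine (x : List (Option Bool)) :
    Turing.initList machine x = cfg (some .read) 0 x [] [] := by
  refine congrArg (fun S => (⟨some .read, .blank 0, S⟩ : Turing.TM2.Cfg Symb Label Reg)) ?_
  funext k
  cases k <;> rfl

lemma haltList_machine (y : List Bool) :
    Turing.haltList machine y = cfg none 0 [] y [] := by
  refine congrArg (fun S => (⟨none, .blank 0, S⟩ : Turing.TM2.Cfg Symb Label Reg)) ?_
  funext k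
  cases k <;> rfl

end LeafHalf

open Classical in
/-- The rows of the adjacency matrix. -/
noncomputable def adjRows {N : ℕ} (G : SimpleGraph (Fin N)) : List (List Bool) :=
  (List.finRange N).map fun i => (List.finRange N).map fun j => decide (G.Adj i j)

lemma encodeGraph_eq_text (G : FinGraph) : encodeGraph G = LeafHalf.text (adjRows G.2) := by
  simp [encodeGraph, LeafHalf.text, adjRows, List.flatMap_map, Function.comp_def]

lemma countP_finRange {N : ℕ} (P : Fin N → Prop) [DecidablePred P] :
    (List.finRange N).countP P = ({i | P i} : Finset (Fin N)).card := by
  rw [List.countP_eq_length_filter, ← List.toFinset_card_of_nodup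
    ((List.nodup_finRange N).filter _), List.toFinset_filter, List.toFinset_finRange]
  simp

open Classical in
lemma count_true_adjRow {N : ℕ} (G : SimpleGraph (Fin N)) (i : Fin N) :
    ((List.finRange N).map fun j => decide (G.Adj i j)).count true = G.degree i := by
  rw [List.count, List.countP_map, ← SimpleGraph.card_neighborFinset_eq_degree,
    G.neighborFinset_eq_filter, ← countP_finRange]
  congr 1
  funext j
  simp

open Classical in
lemma accepts_adjRows_iff {N : ℕ} (G : SimpleGraph (Fin N)) :
    LeafHalf.Accepts 0 (adjRows G) ↔ LeafHalfBalanced G := by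
  -- The row has length `N`, the zero on the diagonal included, so balance means degree exactly `N /
  -- 2`.
  have hhalf : ∀ i, LeafHalf.IsHalfRow ((List.finRange N).map fun j => decide (G.Adj i j)) ↔
      2 * G.degree i = N := by
    intro i
    rw [LeafHalf.IsHalfRow, LeafHalf.excess_eq, count_true_adjRow, List.length_map,
      List.length_finRange]
    omega
  have hleaf : ∀ i, LeafHalf.IsLeafRow ((List.finRange N).map fun j => decide (G.Adj i j)) ↔
      G.degree i = 1 := by
    intro i
    rw [LeafHalf.IsLeafRow, count_true_adjRow]
  simp only [LeafHalf.Accepts, LeafHalfBalanced, adjRows, List.forall_mem_map, List.mem_finRange,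
    List.countP_map, Function.comp_def, hhalf, hleaf, countP_finRange, zero_add,
    Nat.cast_inj, forall_const]

theorem theorem3 :
    PolyTimeSolvableOn
      (fun G : FinGraph => IsInducedFree (SimpleGraph.pathGraph 5) G.2)
      (fun G : FinGraph => CompSubPM G.2) := by
  refine ⟨fun G => decide (LeafHalf.Accepts 0 (adjRows G.1.2)), fun G => ?_, ⟨{
    tm := LeafHalf.machine
    inputAlphabet := Equiv.refl (Option Bool)
    outputAlphabet := Equiv.refl Bool
    time := 3 * Polynomial.X + 3
    outputsFun := fun G => Classical.choice ?_ }⟩⟩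
  · rw [decide_eq_true_iff, accepts_adjRows_iff]
    exact (compSubPM_iff_leafHalfBalanced G.2).symm
  · have h := LeafHalf.runs_read_text (adjRows G.1.2) 0
    rw [← encodeGraph_eq_text] at h
    have hx : (encodeGraph G.1).map (Equiv.refl (Option Bool)).invFun = encodeGraph G.1 :=
      List.map_id _
    have ht : (3 * Polynomial.X + 3 : Polynomial ℕ).eval (encodeGraph G.1).length =
        3 * (encodeGraph G.1).length + (0 : ℤ).natAbs + 3 := by
      simp
    rw [ht]
    unfold Turing.TM2OutputsInTime
    erw [hx, LeafHalf.initList_machine, Option.map_some, LeafHalf.haltList_machine]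
    exact h
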